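/- Let $N\in\mathbb{N}$ and let $\alpha>1$ and $1<q<\frac{N}{2\alpha}$ be real numbers. There is a constant $C>0$, depending only on $N$, $\alpha$ and $q$, such that the following holds. Let $\Omega_1\subset\mathbb{R}^N$ be a bounded domain, let $f\in L^\infty(\Omega_1)$ with $f\ge 0$ a.e. in $\Omega_1$, and let $w\in H_0^{1,2\alpha}(\Omega_1)$ (the closure of $C_c^\infty(\Omega_1)$ in the Sobolev space $W^{1,2\alpha}(\Omega_1)$) be a weak solution of $$-\mathrm{div}\big((1+|\nabla w|^2)^{\alpha-1}\nabla w\big)=f\quad\text{in }\Omega_1,$$ that is, $\int_{\Omega_1}(1+|\nabla w|^2)^{\alpha-1}\nabla w\cdot\nabla\varphi\,dx=\int_{\Omega_1}f\varphi\,dx$ for all $\varphi\in C_c^\infty(\Omega_1)$. Then $$\|w\|_{L^{\frac{Nq(2\alpha-1)}{N-2\alpha q}}(\Omega_1)}\le C\,\|f\|_{L^q(\Omega_1)}^{\frac{1}{2\alpha-1}}.$$ -/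

import Mathlib

open MeasureTheory Filter Topology
open scoped ENNReal ContDiff

/-- `φ ∈ C_c^∞(Ω)`: smooth functions with compact support contained in `Ω`. -/
def IsTestFunction {N : ℕ} (Ω : Set (EuclideanSpace ℝ (Fin N)))
    (φ : EuclideanSpace ℝ (Fin N) → ℝ) : Prop :=
  ContDiff ℝ ∞ φ ∧ HasCompactSupport φ ∧ tsupport φ ⊆ Ω

/-- `G` is the weak (distributional) gradient of `u` in `Ω`. -/
def HasWeakGradient {N : ℕ} (Ω : Set (EuclideanSpace ℝ (Fin N)))
    (u : EuclideanSpace ℝ (Fin N) → ℝ)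
    (G : EuclideanSpace ℝ (Fin N) → EuclideanSpace ℝ (Fin N)) : Prop :=
  LocallyIntegrableOn u Ω ∧ LocallyIntegrableOn G Ω ∧
    ∀ φ : EuclideanSpace ℝ (Fin N) → ℝ, IsTestFunction Ω φ →
      ∫ x in Ω, u x • gradient φ x = -∫ x in Ω, φ x • G x

/-- `u ∈ W^{1,p}(Ω)` with weak gradient `G`. -/
structure MemSobolev {N : ℕ} (Ω : Set (EuclideanSpace ℝ (Fin N))) (p : ℝ≥0∞)
    (u : EuclideanSpace ℝ (Fin N) → ℝ)
    (G : EuclideanSpace ℝ (Fin N) → EuclideanSpace ℝ (Fin N)) : Prop where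
  memLp : MemLp u p (volume.restrict Ω)
  memLp_grad : MemLp G p (volume.restrict Ω)
  hasWeakGradient : HasWeakGradient Ω u G

/-- `u ∈ H_0^{1,p}(Ω)` with weak gradient `G`: `u` lies in `W^{1,p}(Ω)` and is a limit, in the
norm of `W^{1,p}(Ω)`, of functions in `C_c^∞(Ω)`. -/
structure MemSobolevZero {N : ℕ} (Ω : Set (EuclideanSpace ℝ (Fin N))) (p : ℝ≥0∞)
    (u : EuclideanSpace ℝ (Fin N) → ℝ)
    (G : EuclideanSpace ℝ (Fin N) → EuclideanSpace ℝ (Fin N)) : Prop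
    extends MemSobolev Ω p u G where
  exists_approx : ∃ φ : ℕ → EuclideanSpace ℝ (Fin N) → ℝ,
    (∀ n, IsTestFunction Ω (φ n)) ∧
    Tendsto (fun n => eLpNorm (fun x => φ n x - u x) p (volume.restrict Ω)) atTop (𝓝 0) ∧
    Tendsto (fun n => eLpNorm (fun x => gradient (φ n) x - G x) p (volume.restrict Ω))
      atTop (𝓝 0)

/-- `w ∈ H_0^{1,2α}(Ω)` is a weak solution of `-div ((1 + |∇w|²)^(α-1) ∇w) = f` in `Ω`. -/
def IsSacksUhlenbeckSolution {N : ℕ} (α : ℝ) (Ω : Set (EuclideanSpace ℝ (Fin N)))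
    (f w : EuclideanSpace ℝ (Fin N) → ℝ) : Prop :=
  ∃ G : EuclideanSpace ℝ (Fin N) → EuclideanSpace ℝ (Fin N),
    MemSobolevZero Ω (ENNReal.ofReal (2 * α)) w G ∧
    ∀ φ : EuclideanSpace ℝ (Fin N) → ℝ, IsTestFunction Ω φ →
      ∫ x in Ω, inner ℝ ((1 + ‖G x‖ ^ 2) ^ (α - 1) • G x) (gradient φ x) =
        ∫ x in Ω, f x * φ x

/-!
With `p = 2α`, write the equation as `-div A = f` with `A = (1 + |∇w|²)^(α-1) ∇w`, so that
`|∇w|^p ≤ A · ∇w` and `A ∈ L^{p'}`. For a bounded continuous density `ρ ≥ 0` put `Φ(t) = ∫₀ᵗ ρ` and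
`g(t) = ∫₀ᵗ ρ^p`. Testing with `g(w)` gives `∫ |∇Φ(w)|^p ≤ ∫ f g(w)`, hence by the Sobolev and Hölder
inequalities `‖Φ(w)‖_{p*}^p ≤ C ‖f‖_q ‖g(w)‖_{q'}`.

The choice of interest is `ρ(t) = |t|^(k-1)`, where `k p* = r` is the exponent of the
theorem: then `|g| ≤ C₀ |Φ|^γ` with `γ q' = p*`, and since `γ < p` and `k (p - γ) = p - 1` one can
absorb the right-hand side and obtain `‖w‖_r^(p-1) ≤ C ‖f‖_q`.

The power `|t|^(k-1)` is unbounded at infinity if `k > 1`, and at `0` if `k < 1`, which occurs for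
`q` near `1`. It is replaced by `min(|t|, M)^(k-1)` and `(|t| + ε)^(k-1)` respectively.
The bound `|g| ≤ C₀ |Φ|^γ` survives with the same constant, because it follows by differentiation
from `ρ ≤ (kΦ)^(1-1/k)` (`abs_primitiveZero_rpow_le`, `exists_profile_seq`).

The functions `g(w)` are not admissible as they stand. The weak formulation extends by mollification
to `C¹` functions with compact support (`weak_formulation_of_contDiff_one`), in particular to
`g(φ)` with `φ ∈ C_c^∞(Ω)` close to `w` in `W^{1,p}`. The quantity `X = ‖Φ(φ)‖_{p*}` then satisfies
the wanted inequality up to an error vanishing as `φ → w` (`energy_estimate`), and the absorption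
takes place in the limit (`exists_subseq_tendsto_rpow_le`). Fatou's lemma, used for `φ → w` in
`eLpNorm_primitiveZero_comp_le` and for the densities in `eLpNorm_rpow_le_of_forall_profile`,
carries the estimate over to `w`.
-/

/-! ### Bounded densities approximating a power -/

/-- The primitive `t ↦ ∫₀ᵗ ρ` of a real function, normalised to vanish at `0`. -/
noncomputable def primitiveZero (ρ : ℝ → ℝ) (t : ℝ) : ℝ := ∫ s in (0 : ℝ)..t, ρ s

lemma primitiveZero_zero (ρ : ℝ → ℝ) : primitiveZero ρ 0 = 0 := by simp [primitiveZero]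

lemma hasDerivAt_primitiveZero {ρ : ℝ → ℝ} (hρ : Continuous ρ) (t : ℝ) :
    HasDerivAt (primitiveZero ρ) (ρ t) t :=
  intervalIntegral.integral_hasDerivAt_right (hρ.intervalIntegrable _ _)
    (hρ.stronglyMeasurableAtFilter _ _) hρ.continuousAt

lemma contDiff_primitiveZero {ρ : ℝ → ℝ} (hρ : Continuous ρ) : ContDiff ℝ 1 (primitiveZero ρ) := by
  rw [contDiff_one_iff_deriv]
  refine ⟨fun t => (hasDerivAt_primitiveZero hρ t).differentiableAt, ?_⟩
  have : deriv (primitiveZero ρ) = ρ := funext fun t => (hasDerivAt_primitiveZero hρ t).deriv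
  rwa [this]

lemma primitiveZero_neg {ρ : ℝ → ℝ} (hev : ∀ t, ρ (-t) = ρ t) (t : ℝ) :
    primitiveZero ρ (-t) = -primitiveZero ρ t := by
  have h := intervalIntegral.integral_comp_neg (a := 0) (b := t) ρ
  simp only [hev, neg_zero] at h
  rw [primitiveZero, primitiveZero, h, ← intervalIntegral.integral_symm]

lemma abs_primitiveZero {ρ : ℝ → ℝ} (hev : ∀ t, ρ (-t) = ρ t) (h0 : ∀ t, 0 ≤ ρ t) (t : ℝ) :
    |primitiveZero ρ t| = primitiveZero ρ |t| := by
  have hnn : ∀ t, 0 ≤ t → 0 ≤ primitiveZero ρ t := fun t ht =>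
    intervalIntegral.integral_nonneg ht fun s _ => h0 s
  rcases le_total 0 t with ht | ht
  · rw [abs_of_nonneg ht, abs_of_nonneg (hnn t ht)]
  · rw [abs_of_nonpos ht, ← abs_neg, ← primitiveZero_neg hev, abs_of_nonneg (hnn _ (by linarith))]

/-- If `ρ ≤ (kΦ)^(1-1/k)` for the primitive `Φ` of `ρ`, then the primitive of `ρ ^ p` is at most a
multiple of `Φ ^ γ`, where `γ = ((k - 1) p + 1) / k`; the derivative of the difference has a
sign. -/
lemma abs_primitiveZero_rpow_le {ρ : ℝ → ℝ} {k p γ : ℝ} (hk : 0 < k) (hp : 1 < p) (hγ : 0 < γ)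
    (hγk : γ * k = (k - 1) * p + 1) (hρ : Continuous ρ) (hev : ∀ t, ρ (-t) = ρ t)
    (h0 : ∀ t, 0 ≤ ρ t) (hpos : ∀ t, 0 < t → 0 < ρ t)
    (hle : ∀ t, 0 < t → ρ t ≤ (k * primitiveZero ρ t) ^ ((k - 1) / k)) (t : ℝ) :
    |primitiveZero (fun s => ρ s ^ p) t| ≤ k ^ (γ - 1) / γ * |primitiveZero ρ t| ^ γ := by
  have hρp : Continuous fun s => ρ s ^ p := hρ.rpow_const fun _ => Or.inr (by linarith)
  rw [abs_primitiveZero (fun s => by rw [hev]) (fun s => Real.rpow_nonneg (h0 s) p),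
    abs_primitiveZero hev h0]
  have hΦ : ∀ t, 0 < t → 0 < primitiveZero ρ t := fun t ht =>
    intervalIntegral.intervalIntegral_pos_of_pos_on (hρ.intervalIntegrable _ _)
      (fun x hx => hpos x hx.1) ht
  have hmono : MonotoneOn
      (fun t => k ^ (γ - 1) / γ * primitiveZero ρ t ^ γ - primitiveZero (fun s => ρ s ^ p) t)
      (Set.Ici 0) := by
    have hd : ∀ t, 0 < t → HasDerivAt
        (fun t => k ^ (γ - 1) / γ * primitiveZero ρ t ^ γ - primitiveZero (fun s => ρ s ^ p) t)
        (k ^ (γ - 1) / γ * (ρ t * γ * primitiveZero ρ t ^ (γ - 1)) - ρ t ^ p) t := fun t ht =>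
      (((hasDerivAt_primitiveZero hρ t).rpow_const (Or.inl (hΦ t ht).ne')).const_mul _).sub
        (hasDerivAt_primitiveZero hρp t)
    refine monotoneOn_of_deriv_nonneg (convex_Ici 0) ?_ ?_ ?_
    · refine Continuous.continuousOn ?_
      exact (continuous_const.mul ((contDiff_primitiveZero hρ).continuous.rpow_const
        fun _ => Or.inr hγ.le)).sub (contDiff_primitiveZero hρp).continuous
    · intro t ht
      rw [interior_Ici] at ht
      exact (hd t ht).differentiableAt.differentiableWithinAt
    · intro t ht
      rw [interior_Ici] at ht
      have ht : 0 < t := ht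
      rw [(hd t ht).deriv, sub_nonneg]
      have h1 : ρ t ^ p = ρ t * ρ t ^ (p - 1) := by
        rw [Real.rpow_sub_one (hpos t ht).ne']
        field_simp [(hpos t ht).ne']
      have h2 : ρ t ^ (p - 1) ≤ (k * primitiveZero ρ t) ^ (γ - 1) := by
        refine (Real.rpow_le_rpow (h0 t) (hle t ht) (by linarith)).trans_eq ?_
        rw [← Real.rpow_mul (mul_pos hk (hΦ t ht)).le]
        congr 1
        field_simp
        linarith
      rw [Real.mul_rpow hk.le (hΦ t ht).le] at h2
      rw [h1]
      calc ρ t * ρ t ^ (p - 1) ≤ ρ t * (k ^ (γ - 1) * primitiveZero ρ t ^ (γ - 1)) := by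
            gcongr
            exact h0 t
        _ = _ := by field_simp
  have h := hmono (Set.mem_Ici.2 le_rfl) (Set.mem_Ici.2 (abs_nonneg t)) (abs_nonneg t)
  simp only [primitiveZero_zero, Real.zero_rpow hγ.ne', mul_zero, sub_zero] at h
  linarith

/-- The truncated power `min(|t|, M)^(k-1)`, for `k ≥ 1`. -/
lemma truncated_profile {k M : ℝ} (hk : 1 ≤ k) (hM : 0 < M) :
    let ρ : ℝ → ℝ := fun t => min |t| M ^ (k - 1)
    Continuous ρ ∧ (∀ t, ρ t ≤ M ^ (k - 1)) ∧
    (∀ t, 0 < t → ρ t ≤ (k * primitiveZero ρ t) ^ ((k - 1) / k)) ∧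
    ∀ t, |t| ≤ M → primitiveZero ρ |t| = |t| ^ k / k := by
  intro ρ
  have hcont : Continuous ρ :=
    (continuous_abs.min continuous_const).rpow_const fun _ => Or.inr (by linarith)
  have h0 : ∀ t, 0 ≤ ρ t := fun t => Real.rpow_nonneg (le_min (abs_nonneg t) hM.le) _
  have hval : ∀ t, 0 ≤ t → t ≤ M → primitiveZero ρ t = t ^ k / k := by
    intro t ht htM
    have : primitiveZero ρ t = ∫ s in (0 : ℝ)..t, s ^ (k - 1) := by
      refine intervalIntegral.integral_congr fun s hs => ?_
      rw [Set.uIcc_of_le ht] at hs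
      simp only [ρ]
      rw [abs_of_nonneg hs.1, min_eq_left (hs.2.trans htM)]
    rw [this, integral_rpow (Or.inl (by linarith)), sub_add_cancel, Real.zero_rpow (by linarith),
      sub_zero]
  refine ⟨hcont, fun t => ?_, fun t ht => ?_, fun t ht => hval _ (abs_nonneg t) ht⟩
  · exact Real.rpow_le_rpow (le_min (abs_nonneg t) hM.le) (min_le_right _ _) (by linarith)
  · have hm : 0 < min t M := lt_min ht hM
    have h1 : min t M ^ k ≤ k * primitiveZero ρ t := by
      have h2 : primitiveZero ρ (min t M) ≤ primitiveZero ρ t :=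
        intervalIntegral.integral_mono_interval le_rfl hm.le (min_le_left _ _)
          (Eventually.of_forall h0) (hcont.intervalIntegrable _ _)
      rw [hval _ hm.le (min_le_right _ _), div_le_iff₀ (by linarith)] at h2
      linarith
    have h3 : ρ t = (min t M ^ k) ^ ((k - 1) / k) := by
      rw [← Real.rpow_mul hm.le]
      simp only [ρ]
      rw [abs_of_pos ht]
      congr 1
      field_simp
    rw [h3]
    exact Real.rpow_le_rpow (by positivity) h1 (div_nonneg (by linarith) (by linarith))

/-- The shifted power `(|t| + ε)^(k-1)`, for `k < 1`. -/
lemma shifted_profile {k ε : ℝ} (hk : 0 < k) (hk1 : k < 1) (hε : 0 < ε) :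
    let ρ : ℝ → ℝ := fun t => (|t| + ε) ^ (k - 1)
    Continuous ρ ∧ (∀ t, ρ t ≤ ε ^ (k - 1)) ∧
    (∀ t, 0 < t → ρ t ≤ (k * primitiveZero ρ t) ^ ((k - 1) / k)) ∧
    ∀ t, primitiveZero ρ |t| = ((|t| + ε) ^ k - ε ^ k) / k := by
  intro ρ
  have hcont : Continuous ρ :=
    (continuous_abs.add continuous_const).rpow_const fun t =>
      Or.inl (add_pos_of_nonneg_of_pos (abs_nonneg t) hε).ne'
  have hval : ∀ t, 0 ≤ t → primitiveZero ρ t = ((t + ε) ^ k - ε ^ k) / k := by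
    intro t ht
    have : primitiveZero ρ t = ∫ s in (0 : ℝ)..t, (s + ε) ^ (k - 1) := by
      refine intervalIntegral.integral_congr fun s hs => ?_
      rw [Set.uIcc_of_le ht] at hs
      simp only [ρ]
      rw [abs_of_nonneg hs.1]
    rw [this, intervalIntegral.integral_comp_add_right (fun s => s ^ (k - 1)),
      integral_rpow (Or.inl (by linarith)), sub_add_cancel, zero_add]
  refine ⟨hcont, fun t => ?_, fun t ht => ?_, fun t => hval _ (abs_nonneg t)⟩
  · exact Real.rpow_le_rpow_of_nonpos hε (by linarith [abs_nonneg t]) (by linarith)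
  · have h1 : k * primitiveZero ρ t = (t + ε) ^ k - ε ^ k := by
      rw [hval t ht.le]
      field_simp
    have h2 : 0 < (t + ε) ^ k - ε ^ k :=
      sub_pos.2 (Real.rpow_lt_rpow hε.le (by linarith) hk)
    have h3 : ρ t = ((t + ε) ^ k) ^ ((k - 1) / k) := by
      rw [← Real.rpow_mul (by linarith)]
      simp only [ρ]
      rw [abs_of_pos ht]
      congr 1
      field_simp
    rw [h1, h3]
    refine Real.rpow_le_rpow_of_nonpos h2 ?_ (div_nonpos_of_nonpos_of_nonneg (by linarith) hk.le)
    linarith [Real.rpow_pos_of_pos hε k]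

/-- Bounded continuous densities `ρ j` approximating `|t|^(k-1)`: the primitives `Φ j` tend to
`|t|^k / k` in absolute value, and the primitive of `(ρ j)^p` is controlled by `|Φ j|^γ` with a
constant independent of `j`. -/
lemma exists_profile_seq {k p γ : ℝ} (hk : 0 < k) (hp : 1 < p) (hγ : 0 < γ)
    (hγk : γ * k = (k - 1) * p + 1) :
    ∃ ρ : ℕ → ℝ → ℝ, (∀ j, Continuous (ρ j)) ∧ (∀ j t, 0 ≤ ρ j t) ∧ (∀ j, ∃ L, ∀ t, ρ j t ≤ L) ∧
      (∀ j t, |primitiveZero (fun s => ρ j s ^ p) t| ≤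
        k ^ (γ - 1) / γ * |primitiveZero (ρ j) t| ^ γ) ∧
      ∀ t, Tendsto (fun j => |primitiveZero (ρ j) t|) atTop (𝓝 (|t| ^ k / k)) := by
  rcases le_or_gt 1 k with hk1 | hk1
  · have hM : ∀ j : ℕ, (0 : ℝ) < j + 1 := fun j => by positivity
    have h0 : ∀ (j : ℕ) (t : ℝ), 0 ≤ min |t| ((j : ℝ) + 1) ^ (k - 1) := fun j t =>
      Real.rpow_nonneg (le_min (abs_nonneg t) (hM j).le) _
    refine ⟨fun j t => min |t| ((j : ℝ) + 1) ^ (k - 1), fun j => (truncated_profile hk1 (hM j)).1,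
      h0, fun j => ⟨_, (truncated_profile hk1 (hM j)).2.1⟩, fun j t => ?_, fun t => ?_⟩
    · refine abs_primitiveZero_rpow_le hk hp hγ hγk (truncated_profile hk1 (hM j)).1
        (fun t => by rw [abs_neg]) (h0 j) (fun t ht => ?_) (truncated_profile hk1 (hM j)).2.2.1 t
      exact Real.rpow_pos_of_pos (lt_min (abs_pos.2 ht.ne') (hM j)) _
    · refine tendsto_const_nhds.congr' ?_
      obtain ⟨n, hn⟩ := exists_nat_ge |t|
      filter_upwards [eventually_ge_atTop n] with j hj
      rw [abs_primitiveZero (fun t => by rw [abs_neg]) (h0 j),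
        (truncated_profile hk1 (hM j)).2.2.2]
      have : (n : ℝ) ≤ j := by exact_mod_cast hj
      linarith
  · have hε : ∀ j : ℕ, (0 : ℝ) < 1 / ((j : ℝ) + 1) := fun j => by positivity
    have h0 : ∀ (j : ℕ) (t : ℝ), 0 < (|t| + 1 / ((j : ℝ) + 1)) ^ (k - 1) := fun j t => by positivity
    refine ⟨fun j t => (|t| + 1 / ((j : ℝ) + 1)) ^ (k - 1),
      fun j => (shifted_profile hk hk1 (hε j)).1, fun j t => (h0 j t).le,
      fun j => ⟨_, (shifted_profile hk hk1 (hε j)).2.1⟩, fun j t => ?_, fun t => ?_⟩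
    · exact abs_primitiveZero_rpow_le hk hp hγ hγk (shifted_profile hk hk1 (hε j)).1
        (fun t => by rw [abs_neg]) (fun t => (h0 j t).le) (fun t _ => h0 j t)
        (shifted_profile hk hk1 (hε j)).2.2.1 t
    · have h1 : (fun j : ℕ => |primitiveZero (fun t => (|t| + 1 / ((j : ℝ) + 1)) ^ (k - 1)) t|) =
          fun j : ℕ => ((|t| + 1 / ((j : ℝ) + 1)) ^ k - (1 / ((j : ℝ) + 1)) ^ k) / k := by
        funext j
        rw [abs_primitiveZero (fun t => by rw [abs_neg]) (fun t => (h0 j t).le),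
          (shifted_profile hk hk1 (hε j)).2.2.2]
      rw [h1]
      have h2 : Tendsto (fun j : ℕ => 1 / ((j : ℝ) + 1)) atTop (𝓝 0) :=
        tendsto_one_div_add_atTop_nhds_zero_nat
      have h3 := (((h2.const_add |t|).rpow_const (p := k) (Or.inr hk.le)).sub
        (h2.rpow_const (p := k) (Or.inr hk.le))).div_const k
      simpa [Real.zero_rpow hk.ne'] using h3

/-! ### Test functions of class `C¹` -/

lemma norm_gradient_sub_gradient {N : ℕ} (φ ψ : EuclideanSpace ℝ (Fin N) → ℝ)
    (x : EuclideanSpace ℝ (Fin N)) :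
    ‖gradient φ x - gradient ψ x‖ = ‖fderiv ℝ φ x - fderiv ℝ ψ x‖ := by
  simp only [gradient]
  rw [← map_sub, LinearIsometryEquiv.norm_map]

lemma norm_gradient {N : ℕ} (φ : EuclideanSpace ℝ (Fin N) → ℝ) (x : EuclideanSpace ℝ (Fin N)) :
    ‖gradient φ x‖ = ‖fderiv ℝ φ x‖ := by
  simp only [gradient, LinearIsometryEquiv.norm_map]

lemma continuous_gradient {N : ℕ} {φ : EuclideanSpace ℝ (Fin N) → ℝ} (hφ : ContDiff ℝ 1 φ) :
    Continuous (gradient φ) :=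
  (LinearIsometryEquiv.continuous _).comp (hφ.continuous_fderiv one_ne_zero)

lemma hasCompactSupport_gradient {N : ℕ} {φ : EuclideanSpace ℝ (Fin N) → ℝ}
    (hφ : HasCompactSupport φ) : HasCompactSupport (gradient φ) :=
  (hφ.fderiv ℝ).comp_left (map_zero _)

/-- Mollification approximates a `C¹` function with compact support in an open set `Ω`, together
with its gradient, uniformly by functions in `C_c^∞(Ω)`. -/
lemma exists_isTestFunction_approx {N : ℕ} {Ω : Set (EuclideanSpace ℝ (Fin N))} (hΩ : IsOpen Ω)
    {φ : EuclideanSpace ℝ (Fin N) → ℝ} (hφ : ContDiff ℝ 1 φ) (hc : HasCompactSupport φ)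
    (hs : tsupport φ ⊆ Ω) {ε : ℝ} (hε : 0 < ε) :
    ∃ ψ, IsTestFunction Ω ψ ∧ (∀ x, ‖ψ x - φ x‖ ≤ ε) ∧
      ∀ x, ‖gradient ψ x - gradient φ x‖ ≤ ε := by
  obtain ⟨δ, hδ, hδΩ⟩ := hc.isCompact.exists_cthickening_subset_open hΩ hs
  have hfc : Continuous (fderiv ℝ φ) := hφ.continuous_fderiv one_ne_zero
  obtain ⟨δ₁, hδ₁, hu₁⟩ := Metric.uniformContinuous_iff.1
    (hc.uniformContinuous_of_continuous hφ.continuous) ε hε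
  obtain ⟨δ₂, hδ₂, hu₂⟩ := Metric.uniformContinuous_iff.1
    ((hc.fderiv ℝ).uniformContinuous_of_continuous hfc) ε hε
  set r := min δ (min δ₁ δ₂)
  have hr0 : 0 < r := lt_min hδ (lt_min hδ₁ hδ₂)
  let b : ContDiffBump (0 : EuclideanSpace ℝ (Fin N)) := ⟨r / 2, r, by positivity, by linarith⟩
  have hbc : HasCompactSupport (b.normed volume) := b.hasCompactSupport_normed
  let ψ : EuclideanSpace ℝ (Fin N) → ℝ :=
    convolution (b.normed volume) φ (ContinuousLinearMap.lsmul ℝ ℝ) volume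
  have hder : ∀ x, fderiv ℝ ψ x = convolution (b.normed volume) (fderiv ℝ φ)
      (ContinuousLinearMap.lsmul ℝ ℝ) volume x := by
    intro x
    -- The derivative falls on `φ`, so the gradient of the mollification is a mollified gradient.
    have hb : Continuous (b.normed volume) := (b.contDiff_normed (n := 0)).continuous
    have h := hc.hasFDerivAt_convolution_right (ContinuousLinearMap.lsmul ℝ ℝ)
      (hb.locallyIntegrable (μ := volume)) hφ x
    rw [h.fderiv]
    rfl
  refine ⟨ψ, ⟨?_, hbc.convolution _ hc, ?_⟩, fun x => ?_, fun x => ?_⟩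
  · exact hbc.contDiff_convolution_left _ b.contDiff_normed
      (hφ.continuous.locallyIntegrable)
  · refine Set.Subset.trans (closure_minimal ?_ Metric.isClosed_cthickening) hδΩ
    intro x hx
    obtain ⟨y, hy, z, hz, rfl⟩ := Set.mem_add.1 (support_convolution_subset _ hx)
    rw [b.support_normed_eq, mem_ball_zero_iff] at hy
    refine Metric.mem_cthickening_of_dist_le (y + z) z δ _ (subset_closure hz) ?_
    rw [dist_eq_norm, add_sub_cancel_right]
    exact hy.le.trans (min_le_left _ _)
  · rw [← dist_eq_norm]
    refine b.dist_normed_convolution_le hφ.continuous.aestronglyMeasurable fun y hy => ?_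
    exact (hu₁ (lt_of_lt_of_le hy ((min_le_right _ _).trans (min_le_left _ _)))).le
  · rw [norm_gradient_sub_gradient, hder, ← dist_eq_norm]
    refine b.dist_normed_convolution_le hfc.aestronglyMeasurable fun y hy => ?_
    exact (hu₂ (lt_of_lt_of_le hy ((min_le_right _ _).trans (min_le_right _ _)))).le

/-- A weak formulation with integrable data that holds for `C_c^∞(Ω)` test functions holds for
compactly supported `C¹` test functions as well. -/
lemma weak_formulation_of_contDiff_one {N : ℕ} {Ω : Set (EuclideanSpace ℝ (Fin N))}
    (hΩ : IsOpen Ω) {A : EuclideanSpace ℝ (Fin N) → EuclideanSpace ℝ (Fin N)}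
    {f : EuclideanSpace ℝ (Fin N) → ℝ} (hA : Integrable A (volume.restrict Ω))
    (hf : Integrable f (volume.restrict Ω))
    (hweak : ∀ φ, IsTestFunction Ω φ →
      ∫ x in Ω, inner ℝ (A x) (gradient φ x) = ∫ x in Ω, f x * φ x)
    {φ : EuclideanSpace ℝ (Fin N) → ℝ} (hφ : ContDiff ℝ 1 φ) (hc : HasCompactSupport φ)
    (hs : tsupport φ ⊆ Ω) :
    ∫ x in Ω, inner ℝ (A x) (gradient φ x) = ∫ x in Ω, f x * φ x := by
  have hint : ∀ φ : EuclideanSpace ℝ (Fin N) → ℝ, ContDiff ℝ 1 φ → HasCompactSupport φ →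
      Integrable (fun x => inner ℝ (A x) (gradient φ x)) (volume.restrict Ω) ∧
        Integrable (fun x => f x * φ x) (volume.restrict Ω) := by
    intro φ hφ hc
    obtain ⟨K, hK⟩ := hc.exists_bound_of_continuous hφ.continuous
    obtain ⟨K', hK'⟩ :=
      (hasCompactSupport_gradient hc).exists_bound_of_continuous (continuous_gradient hφ)
    constructor
    · refine (hA.norm.mul_const K').mono' (hA.aestronglyMeasurable.inner
        (continuous_gradient hφ).aestronglyMeasurable) (Eventually.of_forall fun x => ?_)
      exact (norm_inner_le_norm _ _).trans (mul_le_mul_of_nonneg_left (hK' x) (norm_nonneg _))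
    · exact hf.mul_bdd hφ.continuous.aestronglyMeasurable (Eventually.of_forall hK)
  set J := ∫ x in Ω, (‖A x‖ + ‖f x‖) with hJ
  have key : ∀ ε : ℝ, 0 < ε →
      |(∫ x in Ω, inner ℝ (A x) (gradient φ x)) - ∫ x in Ω, f x * φ x| ≤ ε * J := by
    intro ε hε
    obtain ⟨ψ, hψ, h1, h2⟩ := exists_isTestFunction_approx hΩ hφ hc hs hε
    have hψ1 : ContDiff ℝ 1 ψ := hψ.1.of_le (by exact_mod_cast le_top)
    obtain ⟨i1, i2⟩ := hint φ hφ hc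
    obtain ⟨i3, i4⟩ := hint ψ hψ1 hψ.2.1
    have e : (∫ x in Ω, inner ℝ (A x) (gradient φ x)) - ∫ x in Ω, f x * φ x =
        ∫ x in Ω, ((inner ℝ (A x) (gradient φ x) - f x * φ x) -
          (inner ℝ (A x) (gradient ψ x) - f x * ψ x)) := by
      have h := integral_sub (i1.sub i2) (i3.sub i4)
      simp only [Pi.sub_apply] at h
      rw [h, integral_sub i1 i2, integral_sub i3 i4, hweak ψ hψ, sub_self, sub_zero]
    rw [e, ← Real.norm_eq_abs, hJ, ← integral_const_mul]
    refine norm_integral_le_of_norm_le ((hA.norm.add hf.norm).const_mul ε)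
      (Eventually.of_forall fun x => ?_)
    have e2 : (inner ℝ (A x) (gradient φ x) - f x * φ x) -
          (inner ℝ (A x) (gradient ψ x) - f x * ψ x) =
        f x * (ψ x - φ x) - inner ℝ (A x) (gradient ψ x - gradient φ x) := by
      rw [inner_sub_right]
      ring
    rw [e2]
    calc _ ≤ ‖f x * (ψ x - φ x)‖ + ‖inner ℝ (A x) (gradient ψ x - gradient φ x)‖ :=
          norm_sub_le _ _
      _ ≤ ‖f x‖ * ε + ‖A x‖ * ε := by
          rw [norm_mul]
          refine add_le_add (mul_le_mul_of_nonneg_left (h1 x) (norm_nonneg _)) ?_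
          exact (norm_inner_le_norm _ _).trans (mul_le_mul_of_nonneg_left (h2 x) (norm_nonneg _))
      _ = _ := by ring
  have hlim : Tendsto (fun ε : ℝ => ε * J) (𝓝[>] 0) (𝓝 0) := by
    have : Tendsto (fun ε : ℝ => ε * J) (𝓝 0) (𝓝 (0 * J)) := tendsto_id.mul_const J
    rw [zero_mul] at this
    exact this.mono_left nhdsWithin_le_nhds
  have := ge_of_tendsto hlim (by filter_upwards [self_mem_nhdsWithin] with ε hε using key ε hε)
  exact sub_eq_zero.1 (abs_nonpos_iff.1 this)

/-! ### Sobolev inequality and energy estimate -/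

/-- The Gagliardo–Nirenberg–Sobolev inequality on an open set, for `C¹` functions with compact
support in that set; the constant does not depend on the set. -/
lemma exists_sobolev_const {N : ℕ} {p ps : ℝ} (hp : 1 ≤ p) (hN : 0 < N) (hps : 0 ≤ ps)
    (h : ps⁻¹ = p⁻¹ - (N : ℝ)⁻¹) :
    ∃ S : NNReal, ∀ (Ω : Set (EuclideanSpace ℝ (Fin N))) (u : EuclideanSpace ℝ (Fin N) → ℝ),
      ContDiff ℝ 1 u → HasCompactSupport u → tsupport u ⊆ Ω →
      eLpNorm u (ENNReal.ofReal ps) (volume.restrict Ω) ≤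
        S * eLpNorm (gradient u) (ENNReal.ofReal p) (volume.restrict Ω) := by
  refine ⟨SNormLESNormFDerivOfEqConst ℝ (volume : Measure (EuclideanSpace ℝ (Fin N)))
    (p.toNNReal : ℝ), fun Ω u hu hc hs => ?_⟩
  have h1 := eLpNorm_le_eLpNorm_fderiv_of_eq (volume : Measure (EuclideanSpace ℝ (Fin N))) hu hc
    (p := p.toNNReal) (p' := ps.toNNReal) (by rwa [Real.one_le_toNNReal]) (by simpa using hN)
    (by simp [hps, (zero_le_one.trans hp), h])
  have h2 : eLpNorm (gradient u) (ENNReal.ofReal p) (volume.restrict Ω) =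
      eLpNorm (fderiv ℝ u) (ENNReal.ofReal p) volume := by
    rw [← eLpNorm_restrict_eq_of_support_subset (f := fderiv ℝ u)
      ((support_fderiv_subset ℝ).trans hs)]
    exact eLpNorm_congr_norm_ae (Eventually.of_forall fun x => norm_gradient u x)
  rw [h2]
  exact (eLpNorm_mono_measure _ Measure.restrict_le_self).trans h1

lemma gradient_comp {N : ℕ} {g g' : ℝ → ℝ} (hg : ∀ t, HasDerivAt g (g' t) t)
    {φ : EuclideanSpace ℝ (Fin N) → ℝ} (hφ : ContDiff ℝ 1 φ) (x : EuclideanSpace ℝ (Fin N)) :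
    gradient (fun y => g (φ y)) x = g' (φ x) • gradient φ x := by
  have h := (hg (φ x)).comp_hasFDerivAt x (hφ.differentiable one_ne_zero x).hasFDerivAt
  have h' : HasFDerivAt (fun y => g (φ y)) (g' (φ x) • fderiv ℝ φ x) x := h
  simp only [gradient]
  rw [h'.fderiv, map_smul]

/-- Hölder's inequality for the norms of two functions with values in different spaces. -/
lemma lintegral_enorm_mul_enorm_le {X E F : Type*} [MeasurableSpace X] {μ : Measure X}
    [NormedAddCommGroup E] [NormedAddCommGroup F] {f : X → E} {g : X → F} {q q' : ℝ}
    (hq : q.HolderConjugate q') (hf : AEStronglyMeasurable f μ) (hg : AEStronglyMeasurable g μ) :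
    ∫⁻ x, ‖f x‖ₑ * ‖g x‖ₑ ∂μ ≤ eLpNorm f (ENNReal.ofReal q) μ * eLpNorm g (ENNReal.ofReal q') μ := by
  rw [eLpNorm_eq_lintegral_rpow_enorm_toReal (by simpa using hq.pos) ENNReal.ofReal_ne_top,
    eLpNorm_eq_lintegral_rpow_enorm_toReal (by simpa using hq.symm.pos) ENNReal.ofReal_ne_top,
    ENNReal.toReal_ofReal hq.nonneg, ENNReal.toReal_ofReal hq.symm.nonneg]
  exact ENNReal.lintegral_mul_le_Lp_mul_Lq μ hq hf.enorm hg.enorm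

/-- The energy estimate: testing `-div A = f` with the primitive of `ρ ^ p` composed with `φ`
bounds the `L^p` norm of `ρ(φ) G` by the `L^(γ q')` norm of the primitive of `ρ` composed with
`φ`, up to an error that is small when `∇φ` is close to `G`. -/
lemma energy_estimate {N : ℕ} {Ω : Set (EuclideanSpace ℝ (Fin N))} (hΩ : IsOpen Ω)
    {p p' q q' γ C₀ L : ℝ} (hp : p.HolderConjugate p') (hq : q.HolderConjugate q') (hγ : 0 < γ)
    {A G : EuclideanSpace ℝ (Fin N) → EuclideanSpace ℝ (Fin N)}
    {f : EuclideanSpace ℝ (Fin N) → ℝ}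
    (hA : MemLp A (ENNReal.ofReal p') (volume.restrict Ω)) (hA1 : Integrable A (volume.restrict Ω))
    (hG : MemLp G (ENNReal.ofReal p) (volume.restrict Ω))
    (hAG : ∀ x, ‖G x‖ ^ p ≤ inner ℝ (A x) (G x))
    (hf : Integrable f (volume.restrict Ω))
    (hweak : ∀ φ, IsTestFunction Ω φ →
      ∫ x in Ω, inner ℝ (A x) (gradient φ x) = ∫ x in Ω, f x * φ x)
    {ρ : ℝ → ℝ} (hρ : Continuous ρ) (hρ0 : ∀ t, 0 ≤ ρ t) (hρL : ∀ t, ρ t ≤ L)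
    (hbd : ∀ t, |primitiveZero (fun s => ρ s ^ p) t| ≤ C₀ * |primitiveZero ρ t| ^ γ)
    {φ : EuclideanSpace ℝ (Fin N) → ℝ} (hφ : ContDiff ℝ 1 φ) (hc : HasCompactSupport φ)
    (hs : tsupport φ ⊆ Ω) :
    eLpNorm (fun x => ρ (φ x) • G x) (ENNReal.ofReal p) (volume.restrict Ω) ^ p ≤
      eLpNorm f (ENNReal.ofReal q) (volume.restrict Ω) * ENNReal.ofReal C₀ *
        eLpNorm (fun x => primitiveZero ρ (φ x)) (ENNReal.ofReal (q' * γ)) (volume.restrict Ω) ^ γ +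
      ENNReal.ofReal (L ^ p) * eLpNorm A (ENNReal.ofReal p') (volume.restrict Ω) *
        eLpNorm (fun x => gradient φ x - G x) (ENNReal.ofReal p) (volume.restrict Ω) := by
  set μ := volume.restrict Ω with hμ
  set g := primitiveZero (fun s => ρ s ^ p) with hg
  have hρp : Continuous fun s => ρ s ^ p := hρ.rpow_const fun _ => Or.inr hp.nonneg
  have hg1 : ContDiff ℝ 1 g := contDiff_primitiveZero hρp
  have hgφ : ContDiff ℝ 1 (fun x => g (φ x)) := hg1.comp hφ
  have hρφ : Continuous fun x => ρ (φ x) ^ p := hρp.comp hφ.continuous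
  have hρφb : ∀ x, ‖ρ (φ x) ^ p‖ ≤ L ^ p := fun x => by
    rw [Real.norm_of_nonneg (Real.rpow_nonneg (hρ0 _) _)]
    exact Real.rpow_le_rpow (hρ0 _) (hρL _) hp.nonneg
  have hgradm : AEStronglyMeasurable (gradient φ) μ := (continuous_gradient hφ).aestronglyMeasurable
  have hgrad : MemLp (gradient φ) (ENNReal.ofReal p) μ :=
    ((continuous_gradient hφ).memLp_of_hasCompactSupport (hasCompactSupport_gradient hc)).restrict _
  have hpair : ∀ H : EuclideanSpace ℝ (Fin N) → EuclideanSpace ℝ (Fin N),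
      MemLp H (ENNReal.ofReal p) μ →
      Integrable (fun x => ρ (φ x) ^ p * inner ℝ (A x) (H x)) μ := by
    intro H hH
    have : Fact (1 ≤ ENNReal.ofReal p) := ⟨by simpa using hp.lt.le⟩
    have hht : (ENNReal.ofReal p).HolderConjugate (ENNReal.ofReal p') := hp.ennrealOfReal
    have h1 : Integrable (fun x => ‖A x‖ * ‖H x‖) μ := 
      hA.norm.integrable_mul (q := ENNReal.ofReal p) hH.norm
    refine Integrable.bdd_mul (c := L ^ p) ?_ hρφ.aestronglyMeasurable (Eventually.of_forall hρφb)
    exact h1.mono' (hA.1.inner hH.1) (Eventually.of_forall fun x => norm_inner_le_norm _ _)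
  -- Split `G = ∇φ + (G - ∇φ)` in the energy and use the weak formulation for the first part.
  have hsplit : ∫ x, ρ (φ x) ^ p * inner ℝ (A x) (G x) ∂μ =
      (∫ x, f x * g (φ x) ∂μ) + ∫ x, ρ (φ x) ^ p * inner ℝ (A x) (G x - gradient φ x) ∂μ := by
    have hg0 : g 0 = 0 := primitiveZero_zero _
    rw [hμ, ← weak_formulation_of_contDiff_one hΩ hA1 hf hweak hgφ (hc.comp_left hg0)
      ((closure_mono (Function.support_comp_subset hg0 φ)).trans hs), ← hμ]
    have e : ∀ x, inner ℝ (A x) (gradient (fun y => g (φ y)) x) =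
        ρ (φ x) ^ p * inner ℝ (A x) (gradient φ x) := fun x => by
      rw [gradient_comp (fun t => hasDerivAt_primitiveZero hρp t) hφ, inner_smul_right]
    simp_rw [e]
    have h := integral_add (hpair _ hgrad) (hpair _ (hG.sub hgrad))
    simp only [Pi.sub_apply] at h
    rw [← h]
    refine integral_congr_ae (Eventually.of_forall fun x => ?_)
    simp only [inner_sub_right]
    ring
  have hlhs : eLpNorm (fun x => ρ (φ x) • G x) (ENNReal.ofReal p) μ ^ p ≤
      ENNReal.ofReal (∫ x, ρ (φ x) ^ p * inner ℝ (A x) (G x) ∂μ) := by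
    rw [eLpNorm_eq_lintegral_rpow_enorm_toReal (by simpa using hp.pos) ENNReal.ofReal_ne_top,
      ENNReal.toReal_ofReal hp.nonneg, ← ENNReal.rpow_mul, one_div, inv_mul_cancel₀ hp.ne_zero,
      ENNReal.rpow_one, ofReal_integral_eq_lintegral_ofReal (hpair G hG)
        (Eventually.of_forall fun x => mul_nonneg (Real.rpow_nonneg (hρ0 _) _)
          ((Real.rpow_nonneg (norm_nonneg _) _).trans (hAG x)))]
    refine lintegral_mono fun x => ?_
    rw [← ofReal_norm, ENNReal.ofReal_rpow_of_nonneg (norm_nonneg _) hp.nonneg, norm_smul,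
      Real.norm_of_nonneg (hρ0 _), Real.mul_rpow (hρ0 _) (norm_nonneg _)]
    exact ENNReal.ofReal_le_ofReal
      (mul_le_mul_of_nonneg_left (hAG x) (Real.rpow_nonneg (hρ0 _) _))
  refine hlhs.trans ?_
  rw [hsplit]
  refine ENNReal.ofReal_add_le.trans (add_le_add ?_ ?_)
  · refine (Real.ofReal_le_enorm _).trans ((enorm_integral_le_lintegral_enorm _).trans ?_)
    simp_rw [enorm_mul]
    refine (lintegral_enorm_mul_enorm_le hq hf.1 hgφ.continuous.aestronglyMeasurable).trans ?_
    rw [mul_assoc]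
    gcongr
    calc eLpNorm (fun x => g (φ x)) (ENNReal.ofReal q') μ
        ≤ ENNReal.ofReal C₀ *
          eLpNorm (fun x => ‖primitiveZero ρ (φ x)‖ ^ γ) (ENNReal.ofReal q') μ := by
          refine eLpNorm_le_mul_eLpNorm_of_ae_le_mul (Eventually.of_forall fun x => ?_) _
          rw [Real.norm_of_nonneg (Real.rpow_nonneg (norm_nonneg _) _)]
          exact hbd (φ x)
      _ = _ := by rw [eLpNorm_norm_rpow _ hγ, ENNReal.ofReal_mul hq.symm.nonneg]
  · refine (Real.ofReal_le_enorm _).trans ((enorm_integral_le_lintegral_enorm _).trans ?_)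
    calc ∫⁻ x, ‖ρ (φ x) ^ p * inner ℝ (A x) (G x - gradient φ x)‖ₑ ∂μ
        ≤ ∫⁻ x, ENNReal.ofReal (L ^ p) * (‖A x‖ₑ * ‖gradient φ x - G x‖ₑ) ∂μ := by
          refine lintegral_mono fun x => ?_
          rw [enorm_mul]
          refine mul_le_mul' ?_ ?_
          · rw [← ofReal_norm]
            exact ENNReal.ofReal_le_ofReal (hρφb x)
          · rw [← ofReal_norm, ← ofReal_norm, ← ofReal_norm, ← ENNReal.ofReal_mul (norm_nonneg _),
              norm_sub_rev (gradient φ x)]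
            exact ENNReal.ofReal_le_ofReal (norm_inner_le_norm _ _)
      _ ≤ _ := by
          rw [lintegral_const_mul' _ _ ENNReal.ofReal_ne_top, mul_assoc]
          gcongr
          exact lintegral_enorm_mul_enorm_le hp.symm hA.1 (hgradm.sub hG.1)

/-- Passing to the limit in a self-improving inequality: if `X ≤ S ((a X^γ + b δ)^(1/p) + L δ)`
with `δ → 0`, then some subsequence of `X` has a limit `x` with `x^(p-γ) ≤ S^p a`. -/
lemma exists_subseq_tendsto_rpow_le {X δ : ℕ → ℝ≥0∞} {S a b L B : ℝ≥0∞} {p γ : ℝ} (hp : 0 < p)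
    (hγp : γ < p) (hS : S ≠ ⊤) (ha : a ≠ ⊤) (hb : b ≠ ⊤) (hL : L ≠ ⊤) (hB : B ≠ ⊤)
    (hδ : Tendsto δ atTop (𝓝 0)) (hXB : ∀ᶠ n in atTop, X n ≤ B)
    (hX : ∀ n, X n ≤ S * ((a * X n ^ γ + b * δ n) ^ (1 / p) + L * δ n)) :
    ∃ (x : ℝ≥0∞) (ns : ℕ → ℕ), StrictMono ns ∧ Tendsto (X ∘ ns) atTop (𝓝 x) ∧
      x ^ (p - γ) ≤ S ^ p * a := by
  obtain ⟨x, ns, hns, hx⟩ := CompactSpace.tendsto_subseq X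
  refine ⟨x, ns, hns, hx, ?_⟩
  have hδ' := hδ.comp hns.tendsto_atTop
  have hxB : x ≤ B := le_of_tendsto hx (hns.tendsto_atTop.eventually hXB)
  have hxtop : x ≠ ⊤ := ne_top_of_le_ne_top hB hxB
  have h1 : Tendsto (fun n => S * ((a * (X ∘ ns) n ^ γ + b * (δ ∘ ns) n) ^ (1 / p) +
      L * (δ ∘ ns) n)) atTop (𝓝 (S * ((a * x ^ γ + b * 0) ^ (1 / p) + L * 0))) := by
    refine ENNReal.Tendsto.const_mul (Tendsto.add (Tendsto.ennrpow_const _ (Tendsto.add ?_ ?_)) ?_)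
      (Or.inr hS)
    · exact ENNReal.Tendsto.const_mul (Tendsto.ennrpow_const _ hx) (Or.inr ha)
    · exact ENNReal.Tendsto.const_mul hδ' (Or.inr hb)
    · exact ENNReal.Tendsto.const_mul hδ' (Or.inr hL)
  have h2 := le_of_tendsto_of_tendsto' hx h1 fun n => hX (ns n)
  rw [mul_zero, mul_zero, add_zero, add_zero] at h2
  rcases eq_or_ne x 0 with h0 | h0
  · rw [h0, ENNReal.zero_rpow_of_pos (by linarith)]
    exact zero_le
  have h3 : x ^ p ≤ S ^ p * a * x ^ γ := by
    refine (ENNReal.rpow_le_rpow h2 hp.le).trans_eq ?_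
    rw [ENNReal.mul_rpow_of_nonneg _ _ hp.le, ← ENNReal.rpow_mul, one_div, inv_mul_cancel₀ hp.ne',
      ENNReal.rpow_one, mul_assoc]
  rw [ENNReal.rpow_sub _ _ h0 hxtop]
  exact ENNReal.div_le_of_le_mul h3

/-! ### Passage to the limit -/

/-- The estimate for a single bounded density `ρ`: it is proved for `C_c^∞` approximations of the
solution and passed to the limit, by Fatou's lemma on the left. -/
lemma eLpNorm_primitiveZero_comp_le {N : ℕ} {Ω : Set (EuclideanSpace ℝ (Fin N))} (hΩ : IsOpen Ω)
    {p p' q q' γ C₀ L : ℝ} {S : ℝ≥0∞} (hp : p.HolderConjugate p') (hq : q.HolderConjugate q')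
    (hγ : 0 < γ) (hγp : γ < p) (hS : S ≠ ⊤)
    (hsob : ∀ u : EuclideanSpace ℝ (Fin N) → ℝ, ContDiff ℝ 1 u → HasCompactSupport u →
      tsupport u ⊆ Ω → eLpNorm u (ENNReal.ofReal (q' * γ)) (volume.restrict Ω) ≤
        S * eLpNorm (gradient u) (ENNReal.ofReal p) (volume.restrict Ω))
    {A G : EuclideanSpace ℝ (Fin N) → EuclideanSpace ℝ (Fin N)}
    {f w : EuclideanSpace ℝ (Fin N) → ℝ}
    (hA : MemLp A (ENNReal.ofReal p') (volume.restrict Ω)) (hA1 : Integrable A (volume.restrict Ω))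
    (hAG : ∀ x, ‖G x‖ ^ p ≤ inner ℝ (A x) (G x))
    (hf : Integrable f (volume.restrict Ω))
    (hfq : MemLp f (ENNReal.ofReal q) (volume.restrict Ω))
    (hweak : ∀ φ, IsTestFunction Ω φ →
      ∫ x in Ω, inner ℝ (A x) (gradient φ x) = ∫ x in Ω, f x * φ x)
    (hw : MemSobolevZero Ω (ENNReal.ofReal p) w G)
    {ρ : ℝ → ℝ} (hρ : Continuous ρ) (hρ0 : ∀ t, 0 ≤ ρ t) (hρL : ∀ t, ρ t ≤ L)
    (hbd : ∀ t, |primitiveZero (fun s => ρ s ^ p) t| ≤ C₀ * |primitiveZero ρ t| ^ γ) :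
    eLpNorm (fun x => primitiveZero ρ (w x)) (ENNReal.ofReal (q' * γ)) (volume.restrict Ω) ^ (p - γ)
      ≤ S ^ p * (eLpNorm f (ENNReal.ofReal q) (volume.restrict Ω) * ENNReal.ofReal C₀) := by
  obtain ⟨φ₀, hφ₀, hφw₀, hφG₀⟩ := hw.exists_approx
  have hφ₀1 : ∀ n, ContDiff ℝ 1 (φ₀ n) := fun n => (hφ₀ n).1.of_le (by exact_mod_cast le_top)
  have hG := hw.memLp_grad
  set μ := volume.restrict Ω with hμ
  have hp1 : 1 ≤ ENNReal.ofReal p := by simpa using hp.lt.le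
  obtain ⟨ms, hms, hae⟩ := (tendstoInMeasure_of_tendsto_eLpNorm (one_pos.trans_le hp1).ne'
    (fun n => (hφ₀1 n).continuous.aestronglyMeasurable) hw.memLp.1 hφw₀).exists_seq_tendsto_ae
  -- From here on the approximations converge almost everywhere.
  set φ : ℕ → EuclideanSpace ℝ (Fin N) → ℝ := fun n => φ₀ (ms n)
  have hφ : ∀ n, IsTestFunction Ω (φ n) := fun n => hφ₀ (ms n)
  have hφ1 : ∀ n, ContDiff ℝ 1 (φ n) := fun n => hφ₀1 (ms n)
  set δ : ℕ → ℝ≥0∞ := fun n => eLpNorm (fun x => gradient (φ n) x - G x) (ENNReal.ofReal p) μ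
  have hδ : Tendsto δ atTop (𝓝 0) := hφG₀.comp hms.tendsto_atTop
  set X : ℕ → ℝ≥0∞ := fun n =>
    eLpNorm (fun x => primitiveZero ρ (φ n x)) (ENNReal.ofReal (q' * γ)) μ
  have hΦ := contDiff_primitiveZero hρ
  have hΦ0 : primitiveZero ρ 0 = 0 := primitiveZero_zero ρ
  have hnorm : ∀ n x, ‖ρ (φ n x)‖ ≤ L := fun n x => by
    rw [Real.norm_of_nonneg (hρ0 _)]
    exact hρL _
  have hbound : ∀ n (H : EuclideanSpace ℝ (Fin N) → EuclideanSpace ℝ (Fin N)),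
      eLpNorm (fun x => ρ (φ n x) • H x) (ENNReal.ofReal p) μ ≤
        ENNReal.ofReal L * eLpNorm H (ENNReal.ofReal p) μ := fun n H => by
    refine eLpNorm_le_mul_eLpNorm_of_ae_le_mul (Eventually.of_forall fun x => ?_) _
    rw [norm_smul]
    exact mul_le_mul_of_nonneg_right (hnorm n x) (norm_nonneg _)
  have hXS : ∀ n, X n ≤ S * (eLpNorm (fun x => ρ (φ n x) • G x) (ENNReal.ofReal p) μ +
      ENNReal.ofReal L * δ n) := by
    intro n
    refine (hsob (fun x => primitiveZero ρ (φ n x)) (hΦ.comp (hφ1 n)) ((hφ n).2.1.comp_left hΦ0)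
      ((closure_mono (Function.support_comp_subset hΦ0 (φ n))).trans (hφ n).2.2)).trans ?_
    gcongr
    have e : gradient (fun x => primitiveZero ρ (φ n x)) =
        (fun x => ρ (φ n x) • G x) + fun x => ρ (φ n x) • (gradient (φ n) x - G x) := by
      funext x
      rw [gradient_comp (fun t => hasDerivAt_primitiveZero hρ t) (hφ1 n), Pi.add_apply, smul_sub]
      abel
    have hm : AEStronglyMeasurable (fun x => ρ (φ n x)) μ :=
      (hρ.comp (hφ1 n).continuous).aestronglyMeasurable
    rw [e]
    refine (eLpNorm_add_le (hm.smul hG.1)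
      (hm.smul ((continuous_gradient (hφ1 n)).aestronglyMeasurable.sub hG.1)) hp1).trans ?_
    exact add_le_add le_rfl (hbound n _)
  obtain ⟨x, ns, hns, hx, hxle⟩ := exists_subseq_tendsto_rpow_le (X := X) (δ := δ) (S := S)
    (a := eLpNorm f (ENNReal.ofReal q) μ * ENNReal.ofReal C₀)
    (b := ENNReal.ofReal (L ^ p) * eLpNorm A (ENNReal.ofReal p') μ) (L := ENNReal.ofReal L)
    (B := S * (ENNReal.ofReal L * eLpNorm G (ENNReal.ofReal p) μ + ENNReal.ofReal L * 1))
    hp.pos hγp hS (ENNReal.mul_ne_top hfq.eLpNorm_ne_top ENNReal.ofReal_ne_top)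
    (ENNReal.mul_ne_top ENNReal.ofReal_ne_top hA.eLpNorm_ne_top) ENNReal.ofReal_ne_top
    (ENNReal.mul_ne_top hS (ENNReal.add_ne_top.2
      ⟨ENNReal.mul_ne_top ENNReal.ofReal_ne_top hG.eLpNorm_ne_top,
        ENNReal.mul_ne_top ENNReal.ofReal_ne_top ENNReal.one_ne_top⟩)) hδ
    (by
      filter_upwards [hδ.eventually_le_const one_pos] with n hn
      refine (hXS n).trans ?_
      gcongr
      exact hbound n G)
    (fun n => by
      refine (hXS n).trans ?_
      gcongr
      rw [one_div, ENNReal.le_rpow_inv_iff hp.pos]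
      exact energy_estimate hΩ hp hq hγ hA hA1 hG hAG hf hweak hρ hρ0 hρL hbd (hφ1 n) (hφ n).2.1
        (hφ n).2.2)
  refine le_trans (ENNReal.rpow_le_rpow ?_ (by linarith)) hxle
  rw [← hx.liminf_eq]
  refine Lp.eLpNorm_lim_le_liminf_eLpNorm
    (f := fun n x => primitiveZero ρ (φ (ns n) x))
    (fun n => (hΦ.continuous.comp (hφ1 _).continuous).aestronglyMeasurable) _ ?_
  filter_upwards [hae] with y hy
  exact (hΦ.continuous.tendsto _).comp (hy.comp hns.tendsto_atTop)

/-- Letting the bounded densities tend to `|t|^(k-1)` gives the bound for `w` itself. -/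
lemma eLpNorm_rpow_le_of_forall_profile {X : Type*} [MeasurableSpace X] {μ : Measure X} {w : X → ℝ}
    (hw : AEStronglyMeasurable w μ) {k s β : ℝ} (hk : 0 < k) (hs : 0 ≤ s) (hβ : 0 < β)
    {K : ℝ≥0∞} {ρ : ℕ → ℝ → ℝ} (hρ : ∀ j, Continuous (ρ j))
    (hlim : ∀ t, Tendsto (fun j => |primitiveZero (ρ j) t|) atTop (𝓝 (|t| ^ k / k)))
    (hle : ∀ j, eLpNorm (fun x => primitiveZero (ρ j) (w x)) (ENNReal.ofReal s) μ ^ β ≤ K) :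
    eLpNorm w (ENNReal.ofReal (s * k)) μ ^ (k * β) ≤ ENNReal.ofReal k ^ β * K := by
  have hF : eLpNorm (fun x => |w x| ^ k / k) (ENNReal.ofReal s) μ ≤ K ^ (1 / β) := by
    refine (Lp.eLpNorm_lim_le_liminf_eLpNorm (f := fun j x => |primitiveZero (ρ j) (w x)|)
      (fun j => ?_) _ (Eventually.of_forall fun x => hlim (w x))).trans ?_
    · exact ((contDiff_primitiveZero (hρ j)).continuous.abs).comp_aestronglyMeasurable hw
    · refine (liminf_le_liminf (v := fun _ => K ^ (1 / β)) (Eventually.of_forall fun j => ?_)).trans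
        (liminf_const _).le
      rw [one_div, ENNReal.le_rpow_inv_iff hβ]
      refine le_trans (le_of_eq ?_) (hle j)
      have e := eLpNorm_norm (p := ENNReal.ofReal s) (μ := μ) fun x => primitiveZero (ρ j) (w x)
      simp only [Real.norm_eq_abs] at e
      rw [e]
  have h1 : eLpNorm w (ENNReal.ofReal (s * k)) μ ^ k =
      ENNReal.ofReal k * eLpNorm (fun x => |w x| ^ k / k) (ENNReal.ofReal s) μ := by
    rw [ENNReal.ofReal_mul hs, ← eLpNorm_norm_rpow _ hk]
    have e : (fun x => ‖w x‖ ^ k) = k • fun x => |w x| ^ k / k := by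
      funext x
      simp only [Pi.smul_apply, smul_eq_mul, Real.norm_eq_abs]
      field_simp
    rw [e, eLpNorm_const_smul, Real.enorm_of_nonneg hk.le]
  rw [ENNReal.rpow_mul, h1, ENNReal.mul_rpow_of_nonneg _ _ hβ.le]
  gcongr
  rwa [one_div, ENNReal.le_rpow_inv_iff hβ] at hF

/-! ### The Sacks–Uhlenbeck operator -/

/-- Coercivity of `v ↦ (1 + |v|²)^(α-1) v` at the exponent `2α`. -/
lemma norm_rpow_le_inner_sacksUhlenbeck {E : Type*} [NormedAddCommGroup E] [InnerProductSpace ℝ E]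
    {α : ℝ} (hα : 1 < α) (v : E) :
    ‖v‖ ^ (2 * α) ≤ inner ℝ ((1 + ‖v‖ ^ 2) ^ (α - 1) • v) v := by
  rw [real_inner_smul_left, real_inner_self_eq_norm_sq]
  have h1 : ‖v‖ ^ (2 * α) = (‖v‖ ^ 2) ^ (α - 1) * ‖v‖ ^ 2 := by
    rw [Real.rpow_mul (norm_nonneg v), Real.rpow_two]
    conv_lhs => rw [show α = α - 1 + 1 by ring]
    rw [Real.rpow_add_one' (by positivity) (by linarith)]
  rw [h1]
  gcongr
  · linarith

lemma norm_sacksUhlenbeck_le {E : Type*} [NormedAddCommGroup E] [InnerProductSpace ℝ E]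
    {α : ℝ} (hα : 1 < α) (v : E) :
    ‖(1 + ‖v‖ ^ 2) ^ (α - 1) • v‖ ≤ (1 + ‖v‖) ^ (2 * α - 1) := by
  have h0 := norm_nonneg v
  rw [norm_smul, Real.norm_of_nonneg (by positivity)]
  calc (1 + ‖v‖ ^ 2) ^ (α - 1) * ‖v‖ ≤ ((1 + ‖v‖) ^ 2) ^ (α - 1) * (1 + ‖v‖) := by
        gcongr
        · linarith
        · nlinarith
    _ = (1 + ‖v‖) ^ (2 * α - 1) := by
        rw [← Real.rpow_two, ← Real.rpow_mul (by positivity),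
          ← Real.rpow_add_one (by positivity)]
        congr 1
        ring

lemma memLp_sacksUhlenbeck {X E : Type*} [MeasurableSpace X] {μ : Measure X} [IsFiniteMeasure μ]
    [NormedAddCommGroup E] [InnerProductSpace ℝ E] {α : ℝ} (hα : 1 < α) {G : X → E}
    (hG : MemLp G (ENNReal.ofReal (2 * α)) μ) :
    MemLp (fun x => (1 + ‖G x‖ ^ 2) ^ (α - 1) • G x)
      (ENNReal.ofReal (2 * α / (2 * α - 1))) μ := by
  have h1 : MemLp (fun x => 1 + ‖G x‖) (ENNReal.ofReal (2 * α)) μ := by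
    have h0 : MemLp (fun _ : X => (1 : ℝ)) (ENNReal.ofReal (2 * α)) μ := memLp_const _
    exact h0.add (g := fun x => ‖G x‖) hG.norm
  have h2 := h1.norm_rpow_div (ENNReal.ofReal (2 * α - 1))
  rw [ENNReal.toReal_ofReal (by linarith), ← ENNReal.ofReal_div_of_pos (by linarith)] at h2
  refine h2.mono ?_ (Eventually.of_forall fun x => ?_)
  · refine AEStronglyMeasurable.smul ?_ hG.1
    exact ((hG.1.norm.aemeasurable.pow_const 2).const_add 1).pow_const (α - 1)
      |>.aestronglyMeasurable
  · refine (norm_sacksUhlenbeck_le hα (G x)).trans ((le_abs_self _).trans_eq' ?_)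
    rw [Real.norm_of_nonneg (by positivity)]

/-! ### The estimate -/

theorem propositionA (N : ℕ) (α : ℝ) (hα : 1 < α) (q : ℝ) (hq : 1 < q)
    (hqN : q < (N : ℝ) / (2 * α)) :
    ∃ C : ℝ, 0 < C ∧
      ∀ Ω : Set (EuclideanSpace ℝ (Fin N)),
        IsOpen Ω → IsConnected Ω → Bornology.IsBounded Ω →
      ∀ f : EuclideanSpace ℝ (Fin N) → ℝ,
        MemLp f ∞ (volume.restrict Ω) → (∀ᵐ x ∂(volume.restrict Ω), 0 ≤ f x) →
      ∀ w : EuclideanSpace ℝ (Fin N) → ℝ, IsSacksUhlenbeckSolution α Ω f w →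
        eLpNorm w (ENNReal.ofReal (N * q * (2 * α - 1) / (N - 2 * α * q)))
            (volume.restrict Ω) ≤
          ENNReal.ofReal C *
            eLpNorm f (ENNReal.ofReal q) (volume.restrict Ω) ^ (1 / (2 * α - 1)) := by
  obtain ⟨p, hpα⟩ : ∃ p, p = 2 * α := ⟨_, rfl⟩
  have hp : 2 < p := by linarith
  rw [lt_div_iff₀ (by linarith), ← hpα] at hqN
  rw [← hpα]
  have hpN : p < N := by nlinarith
  have hN : 0 < N := by
    have : (0 : ℝ) < N := by linarith
    exact_mod_cast this
  have hd : 0 < (N : ℝ) - p * q := by linarith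
  have hd' : 0 < (N : ℝ) - p := by linarith
  -- The exponents: `ps` is the Sobolev exponent of `p`, and `k`, `γ` are determined by
  -- `k * ps = r` and `γ * q' = ps`, where `r` is the exponent in the conclusion.
  obtain ⟨ps, hps⟩ : ∃ ps, ps = N * p / (N - p) := ⟨_, rfl⟩
  obtain ⟨k, hk⟩ : ∃ k, k = q * (p - 1) * (N - p) / (p * (N - p * q)) := ⟨_, rfl⟩
  obtain ⟨γ, hγ⟩ : ∃ γ, γ = ps * (q - 1) / q := ⟨_, rfl⟩
  have hNpos : (0 : ℝ) < N := by linarith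
  have hps0 : 0 < ps := by rw [hps]; positivity
  have hq1 : 0 < q - 1 := by linarith
  have hp1 : 0 < p - 1 := by linarith
  have hq0 : 0 < q := by linarith
  have hp0 : 0 < p := by linarith
  have hk0 : 0 < k := by rw [hk]; positivity
  have hγ0 : 0 < γ := by rw [hγ]; positivity
  have hγk : γ * k = (k - 1) * p + 1 := by
    rw [hγ, hps, hk]
    field_simp
    ring
  have hkβ : k * (p - γ) = p - 1 := by linarith
  have hγp : γ < p := by
    by_contra h
    have : k * (p - γ) ≤ 0 := mul_nonpos_of_nonneg_of_nonpos hk0.le (by linarith)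
    linarith
  have hqc : q.HolderConjugate (q / (q - 1)) := Real.HolderConjugate.conjExponent hq
  have hpc : p.HolderConjugate (p / (p - 1)) := Real.HolderConjugate.conjExponent (by linarith)
  have hqγ : q / (q - 1) * γ = ps := by
    rw [hγ]
    field_simp
  have hr : N * q * (p - 1) / (N - p * q) = ps * k := by
    rw [hps, hk]
    field_simp
  obtain ⟨S, hS⟩ := exists_sobolev_const (N := N) (p := p) (ps := ps) (by linarith) hN hps0.le
    (by rw [hps]; field_simp)
  obtain ⟨ρ, hρ, hρ0, hρL, hbd, hlim⟩ := exists_profile_seq hk0 (by linarith : 1 < p) hγ0 hγk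
  set C₀ := k ^ (γ - 1) / γ
  set K : ℝ≥0∞ := ENNReal.ofReal k ^ (p - γ) * ((S : ℝ≥0∞) ^ p * ENNReal.ofReal C₀) with hK
  have hKtop : K ^ (1 / (p - 1)) ≠ ⊤ := by
    refine ENNReal.rpow_ne_top_of_nonneg (by positivity) (ENNReal.mul_ne_top ?_
      (ENNReal.mul_ne_top ?_ ENNReal.ofReal_ne_top))
    · exact ENNReal.rpow_ne_top_of_nonneg (by linarith) ENNReal.ofReal_ne_top
    · exact ENNReal.rpow_ne_top_of_nonneg hp0.le ENNReal.coe_ne_top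
  refine ⟨(K ^ (1 / (p - 1))).toReal + 1, by positivity, ?_⟩
  rintro Ω hΩ - hΩb f hf - w ⟨G, hw, hweak⟩
  have : IsFiniteMeasure (volume.restrict Ω) := ⟨by simpa using hΩb.measure_lt_top⟩
  rw [← hpα] at hw
  have hA : MemLp (fun x => (1 + ‖G x‖ ^ 2) ^ (α - 1) • G x)
      (ENNReal.ofReal (p / (p - 1))) (volume.restrict Ω) := by
    have := hw.memLp_grad
    rw [hpα] at this ⊢
    exact memLp_sacksUhlenbeck hα this
  have hA1 := hA.integrable (by simpa using hpc.symm.lt.le)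
  have hfq : MemLp f (ENNReal.ofReal q) (volume.restrict Ω) := hf.mono_exponent le_top
  have hprof := eLpNorm_rpow_le_of_forall_profile hw.memLp.1 hk0 hps0.le (sub_pos.2 hγp) hρ hlim
    (fun j => by
      obtain ⟨L, hL⟩ := hρL j
      have h := eLpNorm_primitiveZero_comp_le hΩ hpc hqc hγ0 hγp ENNReal.coe_ne_top
        (by rw [hqγ]; exact hS Ω) hA hA1
        (fun x => by rw [hpα]; exact norm_rpow_le_inner_sacksUhlenbeck hα (G x))
        (hf.integrable le_top) hfq hweak hw (hρ j) (hρ0 j) hL (hbd j)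
      rwa [hqγ] at h)
  rw [hkβ] at hprof
  rw [hr]
  calc eLpNorm w (ENNReal.ofReal (ps * k)) (volume.restrict Ω)
      ≤ (K * eLpNorm f (ENNReal.ofReal q) (volume.restrict Ω)) ^ (1 / (p - 1)) := by
        rw [one_div, ENNReal.le_rpow_inv_iff hp1]
        refine hprof.trans_eq ?_
        rw [hK]
        ring
    _ = K ^ (1 / (p - 1)) * eLpNorm f (ENNReal.ofReal q) (volume.restrict Ω) ^ (1 / (p - 1)) :=
        ENNReal.mul_rpow_of_nonneg _ _ (by positivity)
    _ ≤ _ := by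
        gcongr
        rw [ENNReal.le_ofReal_iff_toReal_le hKtop (by positivity)]
        linarith
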